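/- Let $d \ge 1$ be an integer and let $S^d = \{x \in \mathbb{R}^{d+1} : |x| = 1\}$, with $\sigma_d$ its surface measure normalized to total mass $1$. For points $x_1,\dots,x_N \in S^d$, $N \ge 2$, let $$\vartheta(\{x_1,\dots,x_N\}) = \min_{1 \le j < k \le N} \arccos (x_j \cdot x_k)$$ be their minimal geodesic distance. Put $\omega_n = 2\pi^{(n+1)/2}/\Gamma((n+1)/2)$ (the surface area of $S^n$, $\omega_0 = 2$) and $$\kappa_d = \frac{1}{d}\,\frac{\omega_{d-1}}{\omega_d}.$$ For every $N$ let $X_N$ be a set of $N$ independent random points on $S^d$, each with distribution $\sigma_d$. Then, for $N \ge 2$, the random variable $N^{2/d}\,\vartheta(X_N)$ has finite second moment, and as $N \to \infty$ $$\mathbb{E}\bigl[N^{2/d}\,\vartheta(X_N)\bigr] \to C_d := \Bigl(\frac{\kappa_d}{2}\Bigr)^{-1/d}\,\Gamma\Bigl(1+\frac1d\Bigr)$$ and $$\operatorname{Var}\bigl(N^{2/d}\,\vartheta(X_N)\bigr) \to \Bigl(\frac{\kappa_d}{2}\Bigr)^{-2/d}\left(\Gamma\Bigl(1+\frac2d\Bigr)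 - \Bigl[\Gamma\Bigl(1+\frac1d\Bigr)\Bigr]^2\right).$$ -/

import Mathlib

open MeasureTheory ProbabilityTheory Filter Topology

noncomputable section

/-- The unit sphere `S^d` in `ℝ^(d+1)`. -/
abbrev UnitSphere (d : ℕ) : Type :=
  Metric.sphere (0 : EuclideanSpace ℝ (Fin (d + 1))) 1

/-- The uniform distribution `σ_d` on `S^d`: the surface measure, normalized to total mass one. -/
def uniformSphere (d : ℕ) : Measure (UnitSphere d) :=
  ((volume : Measure (EuclideanSpace ℝ (Fin (d + 1)))).toSphere Set.univ)⁻¹ •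
    (volume : Measure (EuclideanSpace ℝ (Fin (d + 1)))).toSphere

/-- The geodesic (great circle) distance of two points of `S^d`, that is, the angle in `[0, π]`
between them. -/
def geodesicDist {d : ℕ} (x y : UnitSphere d) : ℝ :=
  Real.arccos (inner ℝ (x : EuclideanSpace ℝ (Fin (d + 1))) (y : EuclideanSpace ℝ (Fin (d + 1))))

/-- The separation of a configuration of `N` points: the least geodesic distance between
two points with different indices. It is a minimum for `N ≥ 2`
(and has the default value `0` for `N < 2`). -/
def separation {d N : ℕ} (x : Fin N → UnitSphere d) : ℝ :=
  ⨅ p : {p : Fin N × Fin N // p.1 < p.2}, geodesicDist (x p.1.1) (x p.1.2)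

/-- The surface area `ω_n = 2 π^((n+1)/2) / Γ((n+1)/2)` of `S^n`; in particular `ω_0 = 2`. -/
def sphereArea (n : ℕ) : ℝ :=
  2 * Real.pi ^ (((n : ℝ) + 1) / 2) / Real.Gamma (((n : ℝ) + 1) / 2)

/-- `κ_d = (1 / d) ω_{d-1} / ω_d` (used for `d ≥ 1` only). -/
def kappa (d : ℕ) : ℝ :=
  1 / (d : ℝ) * (sphereArea (d - 1) / sphereArea d)

end

/-! Put `r = t / N^(2/d)`. The rescaled separation exceeds `t` exactly when no two points lie within
distance `r`. A fixed pair is that close with probability `v ~ κ_d r^d = κ_d t^d / N²`, and there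
are about `N²/2` pairs, so the survival function should tend to the Weibull one, `exp (-(κ_d / 2)
t^d)`.

To prove this, points are added one at a time: a new point avoids the caps around `k` spread points
with probability about `1 - k v`, with Bonferroni controlling the overlaps. The accumulated error
`N³ v²` is `O(1/N)` (`abs_measureReal_spread_sub_exp_le`, `tendsto_survival`).

Moments follow by dominated convergence in the layer-cake formula. The dominating tail comes from
packing: caps of radius `r/2` around points more than `r` apart are disjoint
(`measureReal_spread_le_exp`, `exists_tail_bound`). The asymptotics of cap measures come from
comparing the cone over a cap with straight cones (`tendsto_capMeasure_div_pow`). -/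

/-- Second-order Bonferroni inequality: a finite union has at least the sum of the measures
minus the measures of the (ordered) pairwise intersections. -/
lemma sum_measureReal_le_biUnion_add_pairs {α ι : Type*} [MeasurableSpace α] [DecidableEq ι]
    (μ : Measure α) [IsFiniteMeasure μ] (E : ι → Set α) (hE : ∀ i, MeasurableSet (E i))
    (s : Finset ι) :
    ∑ i ∈ s, μ.real (E i) ≤
      μ.real (⋃ i ∈ s, E i) + ∑ i ∈ s, ∑ j ∈ s.erase i, μ.real (E i ∩ E j) := by
  induction s using Finset.induction_on with
  | empty => simp
  | insert a s ha ih =>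
    rw [Finset.sum_insert ha, Finset.sum_insert ha, Finset.set_biUnion_insert,
      Finset.erase_insert ha]
    have hU : MeasurableSet (⋃ i ∈ s, E i) := s.measurableSet_biUnion fun i _ => hE i
    have h1 := measureReal_union_add_inter (μ := μ) (s := E a) hU (measure_ne_top _ _) (measure_ne_top _ _)
    have h2 : μ.real (E a ∩ ⋃ i ∈ s, E i) ≤ ∑ j ∈ s, μ.real (E a ∩ E j) := by
      rw [Set.inter_iUnion₂]
      exact measureReal_biUnion_finset_le s _
    have h3 : ∑ i ∈ s, ∑ j ∈ s.erase i, μ.real (E i ∩ E j) ≤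
        ∑ i ∈ s, ∑ j ∈ (insert a s).erase i, μ.real (E i ∩ E j) := by
      refine Finset.sum_le_sum fun i _ => Finset.sum_le_sum_of_subset_of_nonneg
        (Finset.erase_subset_erase _ (Finset.subset_insert _ _)) fun _ _ _ => measureReal_nonneg
    linarith

/-! ### Independent points avoiding a relation, added one at a time -/

section Spread

variable {S : Type*}

/-- The configurations of `k` points no two of which are related by `R`. -/
def spread (R : S → S → Prop) (k : ℕ) : Set (Fin k → S) :=
  {x | ∀ i j, i < j → ¬ R (x i) (x j)}

/-- The event that the new point `p.1` is related to the `i`-th point of the spread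
configuration `p.2`. -/
def hit (R R' : S → S → Prop) {k : ℕ} (i : Fin k) : Set (S × (Fin k → S)) :=
  {p | p.2 ∈ spread R k ∧ R' p.1 (p.2 i)}

variable [MeasurableSpace S]

lemma measurableSet_spread {R : S → S → Prop} (hR : MeasurableSet {p : S × S | R p.1 p.2})
    (k : ℕ) : MeasurableSet (spread R k) := by
  simp only [spread, Set.ofPred_forall]
  refine MeasurableSet.iInter fun i => MeasurableSet.iInter fun j => MeasurableSet.iInter fun _ => ?_
  have hm : Measurable fun x : Fin k → S => (x i, x j) :=
    (measurable_pi_apply i).prodMk (measurable_pi_apply j)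
  exact (hR.preimage hm).compl

lemma measurableSet_hit {R R' : S → S → Prop} (hR : MeasurableSet {p : S × S | R p.1 p.2})
    (hR' : MeasurableSet {p : S × S | R' p.1 p.2}) {k : ℕ} (i : Fin k) :
    MeasurableSet (hit R R' i) := by
  refine ((measurableSet_spread hR k).preimage measurable_snd).inter ?_
  exact hR'.preimage (measurable_fst.prodMk ((measurable_pi_apply i).comp measurable_snd))

variable (μ : Measure S) [IsProbabilityMeasure μ]

/-- Fubini with the new point integrated first: whatever the spread configuration, the conditional
probability is `v`. Allowing `R'` to differ from `R` serves the packing bound, where `R'` is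
closeness at half the radius. -/
lemma measureReal_hit {R R' : S → S → Prop} (hR : MeasurableSet {p : S × S | R p.1 p.2})
    (hR' : MeasurableSet {p : S × S | R' p.1 p.2}) {v : ℝ} (hv : ∀ x, μ.real {y | R' y x} = v)
    {k : ℕ} (i : Fin k) :
    (μ.prod (Measure.pi fun _ : Fin k => μ)).real (hit R R' i) =
      v * (Measure.pi fun _ : Fin k => μ).real (spread R k) := by
  have h : ∀ x : Fin k → S, μ ((fun y => (y, x)) ⁻¹' hit R R' i) =
      (spread R k).indicator (fun _ => ENNReal.ofReal v) x := by
    intro x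
    by_cases hx : x ∈ spread R k
    · simp only [hit, Set.preimage_ofPred_eq, hx, true_and, Set.indicator_of_mem]
      rw [← hv (x i), ofReal_measureReal]
    · simp [hit, hx]
  have hv0 : 0 ≤ v := by
    obtain ⟨x⟩ := μ.nonempty_of_neZero
    exact hv x ▸ measureReal_nonneg
  rw [measureReal_def, Measure.prod_apply_symm (measurableSet_hit hR hR' i)]
  simp_rw [h]
  rw [lintegral_indicator_const (measurableSet_spread hR k), ENNReal.toReal_mul,
    ENNReal.toReal_ofReal hv0, measureReal_def]

/-- Drop the spread condition and fix the new point instead: the `i`-th and `j`-th points are then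
independent, and each is related to it with probability `v`. -/
lemma measureReal_hit_inter_hit_le {R : S → S → Prop}
    (hR : MeasurableSet {p : S × S | R p.1 p.2}) {v : ℝ}
    (hv' : ∀ x, μ.real {y | R x y} = v) {k : ℕ} {i j : Fin k} (hij : i ≠ j) :
    (μ.prod (Measure.pi fun _ : Fin k => μ)).real (hit R R i ∩ hit R R j) ≤ v ^ 2 := by
  have hsub : hit R R i ∩ hit R R j ⊆ {p | R p.1 (p.2 i) ∧ R p.1 (p.2 j)} :=
    fun p hp => ⟨hp.1.2, hp.2.2⟩
  have hmeas : MeasurableSet {p : S × (Fin k → S) | R p.1 (p.2 i) ∧ R p.1 (p.2 j)} := by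
    refine MeasurableSet.inter ?_ ?_
    · exact hR.preimage (measurable_fst.prodMk ((measurable_pi_apply i).comp measurable_snd))
    · exact hR.preimage (measurable_fst.prodMk ((measurable_pi_apply j).comp measurable_snd))
  have hv0 : 0 ≤ v := by
    obtain ⟨x⟩ := μ.nonempty_of_neZero
    exact hv' x ▸ measureReal_nonneg
  have h : ∀ y, (Measure.pi fun _ : Fin k => μ)
      (Prod.mk y ⁻¹' {p : S × (Fin k → S) | R p.1 (p.2 i) ∧ R p.1 (p.2 j)}) =
      ENNReal.ofReal (v ^ 2) := by
    intro y
    have : Prod.mk y ⁻¹' {p : S × (Fin k → S) | R p.1 (p.2 i) ∧ R p.1 (p.2 j)} =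
        Set.univ.pi fun l => if l ∈ ({i, j} : Finset (Fin k)) then {z | R y z} else Set.univ := by
      ext x
      simp only [Set.mem_preimage, Set.mem_ofPred_eq, Set.mem_univ_pi]
      constructor
      · rintro ⟨h1, h2⟩ l
        split_ifs with hl
        · rcases Finset.mem_insert.1 hl with rfl | hl
          · exact h1
          · rw [Finset.mem_singleton.1 hl]; exact h2
        · trivial
      · intro h
        exact ⟨by simpa using h i, by simpa using h j⟩
    rw [this, Measure.pi_pi]
    have h2 : ∀ l, μ (if l ∈ ({i, j} : Finset (Fin k)) then {z | R y z} else Set.univ) =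
        if l ∈ ({i, j} : Finset (Fin k)) then ENNReal.ofReal v else 1 := by
      intro l
      split_ifs
      · rw [← hv' y, ofReal_measureReal]
      · exact measure_univ
    simp_rw [h2]
    rw [Finset.prod_ite_mem, Finset.univ_inter, Finset.prod_const, Finset.card_pair hij,
      ENNReal.ofReal_pow hv0]
  refine (measureReal_mono hsub).trans ?_
  rw [measureReal_def, Measure.prod_apply hmeas]
  simp_rw [h]
  simp [sq_nonneg]

lemma measureReal_spread_succ {R : S → S → Prop} (hR : MeasurableSet {p : S × S | R p.1 p.2})
    (k : ℕ) :
    (Measure.pi fun _ : Fin (k + 1) => μ).real (spread R (k + 1)) =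
      (Measure.pi fun _ : Fin k => μ).real (spread R k) -
        (μ.prod (Measure.pi fun _ : Fin k => μ)).real (⋃ i, hit R R i) := by
  set Q := μ.prod (Measure.pi fun _ : Fin k => μ)
  have hU : MeasurableSet (⋃ i : Fin k, hit R R i) :=
    MeasurableSet.iUnion fun i => measurableSet_hit hR hR i
  have hsub : (⋃ i : Fin k, hit R R i) ⊆ Set.univ ×ˢ spread R k :=
    Set.iUnion_subset fun i p hp => ⟨trivial, hp.1⟩
  have h1 : Q.real (Set.univ ×ˢ spread R k) =
      (Measure.pi fun _ : Fin k => μ).real (spread R k) := by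
    rw [measureReal_prod_prod]; simp
  have hpre : spread R (k + 1) = MeasurableEquiv.piFinSuccAbove (fun _ => S) 0 ⁻¹'
      ((Set.univ ×ˢ spread R k) \ ⋃ i, hit R R i) := by
    ext x
    simp only [spread, hit, MeasurableEquiv.piFinSuccAbove, Set.mem_ofPred_eq, Set.mem_preimage,
      Set.mem_sdiff, Set.mem_prod, Set.mem_univ, true_and, Set.mem_iUnion, not_exists, not_and]
    constructor
    · intro h
      exact ⟨fun i j hij => h i.succ j.succ (Fin.succ_lt_succ_iff.2 hij),
        fun j _ => h 0 j.succ (Fin.succ_pos j)⟩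
    · rintro ⟨h1, h2⟩ i j hij
      induction j using Fin.cases with
      | zero => exact absurd hij (Fin.not_lt_zero i)
      | succ j =>
        induction i using Fin.cases with
        | zero => exact h2 j h1
        | succ i => exact h1 i j (Fin.succ_lt_succ_iff.1 hij)
  have hmp := measurePreserving_piFinSuccAbove (fun _ : Fin (k + 1) => μ) 0
  have hm : MeasurableSet ((Set.univ ×ˢ spread R k) \ ⋃ i, hit R R i) :=
    (MeasurableSet.univ.prod (measurableSet_spread hR k)).diff hU
  rw [hpre, ← h1, ← measureReal_sdiff hsub hU, measureReal_def, measureReal_def,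
    hmp.measure_preimage hm.nullMeasurableSet]

lemma Real.exp_neg_le_one_sub_add_sq {x : ℝ} (hx : 0 ≤ x) : Real.exp (-x) ≤ 1 - x + x ^ 2 := by
  rcases le_total x 1 with h | h
  · have := (abs_le.1 (Real.abs_exp_sub_one_sub_id_le (x := -x) (by rwa [abs_neg, abs_of_nonneg hx]))).2
    nlinarith
  · have := Real.exp_le_one_iff.2 (neg_nonpos.2 hx)
    nlinarith

/-- The union of hits has probability at most `k v a`, and at least `k v a - k² v²` by Bonferroni.
Combined with `1 - x ≤ exp (-x) ≤ 1 - x + x²` at `x = k v`, each side of the estimate uses only one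
of the two quadratic errors. -/
lemma abs_measureReal_spread_succ_sub_le {R : S → S → Prop}
    (hR : MeasurableSet {p : S × S | R p.1 p.2}) {v : ℝ}
    (hv : ∀ x, μ.real {y | R y x} = v) (hv' : ∀ x, μ.real {y | R x y} = v) (k : ℕ) :
    |(Measure.pi fun _ : Fin (k + 1) => μ).real (spread R (k + 1)) -
      Real.exp (-(k * v)) * (Measure.pi fun _ : Fin k => μ).real (spread R k)| ≤
      (k : ℝ) ^ 2 * v ^ 2 := by
  rw [measureReal_spread_succ μ hR]
  set a := (Measure.pi fun _ : Fin k => μ).real (spread R k)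
  set Q := μ.prod (Measure.pi fun _ : Fin k => μ)
  have hv0 : 0 ≤ v := by
    obtain ⟨x⟩ := μ.nonempty_of_neZero
    exact hv x ▸ measureReal_nonneg
  have ha0 : 0 ≤ a := measureReal_nonneg
  have ha1 : a ≤ 1 := measureReal_le_one
  have hup : Q.real (⋃ i, hit R R i) ≤ k * v * a := by
    refine (measureReal_iUnion_fintype_le _).trans ?_
    simp [Q, measureReal_hit μ hR hR hv, a, mul_assoc]
  have hlo : k * v * a ≤ Q.real (⋃ i, hit R R i) + (k : ℝ) ^ 2 * v ^ 2 := by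
    have h := sum_measureReal_le_biUnion_add_pairs Q (fun i : Fin k => hit R R i)
      (fun i => measurableSet_hit hR hR i) Finset.univ
    have h2 : ∑ i : Fin k, ∑ j ∈ Finset.univ.erase i, Q.real (hit R R i ∩ hit R R j) ≤
        ∑ i : Fin k, ∑ j : Fin k, v ^ 2 := by
      refine Finset.sum_le_sum fun i _ => ?_
      refine (Finset.sum_le_sum fun j hj => measureReal_hit_inter_hit_le μ hR hv'
        (Finset.ne_of_mem_erase hj).symm).trans ?_
      exact Finset.sum_le_sum_of_subset_of_nonneg (Finset.erase_subset _ _)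
        fun _ _ _ => sq_nonneg v
    simp only [Finset.mem_univ, Set.iUnion_true] at h
    simp only [Q, measureReal_hit μ hR hR hv, Finset.sum_const, Finset.card_univ,
      Fintype.card_fin, nsmul_eq_mul] at h h2
    linarith
  have hkv : 0 ≤ k * v := by positivity
  have e1 := Real.exp_neg_le_one_sub_add_sq hkv
  have e2 := Real.add_one_le_exp (-(k * v))
  rw [abs_le]
  constructor
  · nlinarith [mul_le_mul_of_nonneg_right e1 ha0,
      mul_le_mul_of_nonneg_left ha1 (sq_nonneg (k * v))]
  · nlinarith [mul_le_mul_of_nonneg_right e2 ha0]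

/-- If every point is related to a set of points of measure `v`, the probability that `N`
independent points are pairwise unrelated is `exp (-v N (N - 1) / 2)`, up to an error `N³ v²`. -/
theorem abs_measureReal_spread_sub_exp_le {R : S → S → Prop}
    (hR : MeasurableSet {p : S × S | R p.1 p.2}) {v : ℝ}
    (hv : ∀ x, μ.real {y | R y x} = v) (hv' : ∀ x, μ.real {y | R x y} = v) (N : ℕ) :
    |(Measure.pi fun _ : Fin N => μ).real (spread R N) -
      Real.exp (-(N * (N - 1) / 2 * v))| ≤ (N : ℝ) ^ 3 * v ^ 2 := by
  have hv0 : 0 ≤ v := by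
    obtain ⟨x⟩ := μ.nonempty_of_neZero
    exact hv x ▸ measureReal_nonneg
  induction N with
  | zero => simp [spread]
  | succ k ih =>
    have h := abs_measureReal_spread_succ_sub_le μ hR hv hv' k
    set a := (Measure.pi fun _ : Fin k => μ).real (spread R k)
    set b := (Measure.pi fun _ : Fin (k + 1) => μ).real (spread R (k + 1))
    have he : Real.exp (-(((k + 1 : ℕ) : ℝ) * ((k + 1 : ℕ) - 1) / 2 * v)) =
        Real.exp (-(k * v)) * Real.exp (-((k : ℝ) * (k - 1) / 2 * v)) := by
      rw [← Real.exp_add]; congr 1; push_cast; ring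
    have h1 : Real.exp (-(k * v)) ≤ 1 := Real.exp_le_one_iff.2 (neg_nonpos.2 (by positivity))
    have h2 : b - Real.exp (-(((k + 1 : ℕ) : ℝ) * ((k + 1 : ℕ) - 1) / 2 * v)) =
        (b - Real.exp (-(k * v)) * a) +
          Real.exp (-(k * v)) * (a - Real.exp (-((k : ℝ) * (k - 1) / 2 * v))) := by
      rw [he]; ring
    rw [h2]
    refine (abs_add_le _ _).trans ?_
    rw [abs_mul, abs_of_pos (Real.exp_pos _)]
    have h3 := mul_le_mul h1 ih (abs_nonneg _) zero_le_one
    push_cast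
    -- The factor `exp (-(k v)) ≤ 1` does not enlarge the old error, so errors add up; this is the
    -- slack in `k³ + k² ≤ (k + 1)³`.
    have h4 : 0 ≤ (2 * (k : ℝ) ^ 2 + 3 * k + 1) * v ^ 2 := by positivity
    nlinarith

/-- If `R'`-neighbourhoods of `R`-unrelated points are disjoint, then `N` independent points are
pairwise `R`-unrelated with probability at most `exp (-w N (N - 1) / 2)`, where `w` is the measure
of an `R'`-neighbourhood. -/
theorem measureReal_spread_le_exp {R R' : S → S → Prop}
    (hR : MeasurableSet {p : S × S | R p.1 p.2}) (hR' : MeasurableSet {p : S × S | R' p.1 p.2})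
    {w : ℝ} (hw : ∀ x, μ.real {y | R' y x} = w) (hsub : ∀ x y, R' x y → R x y)
    (hdisj : ∀ x y z, R' z x → R' z y → R x y) (N : ℕ) :
    (Measure.pi fun _ : Fin N => μ).real (spread R N) ≤ Real.exp (-(N * (N - 1) / 2 * w)) := by
  induction N with
  | zero => simp [spread]
  | succ k ih =>
    rw [measureReal_spread_succ μ hR]
    set a := (Measure.pi fun _ : Fin k => μ).real (spread R k)
    set Q := μ.prod (Measure.pi fun _ : Fin k => μ)
    -- Disjoint hits have exactly additive probabilities, so there is no Bonferroni error and the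
    -- bound holds at every scale.
    have hQ : k * w * a ≤ Q.real (⋃ i, hit R R i) := by
      have hd : Pairwise (Function.onFun Disjoint fun i : Fin k => hit R R' i) := by
        intro i j hij
        refine Set.disjoint_left.2 fun p hi hj => ?_
        rcases lt_or_gt_of_ne hij with h | h
        · exact hi.1 i j h (hdisj _ _ _ hi.2 hj.2)
        · exact hi.1 j i h (hdisj _ _ _ hj.2 hi.2)
      calc k * w * a = ∑ i : Fin k, Q.real (hit R R' i) := by
            simp [Q, measureReal_hit μ hR hR' hw, a, mul_assoc]
        _ = Q.real (⋃ i, hit R R' i) :=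
            (measureReal_iUnion_fintype hd fun i => measurableSet_hit hR hR' i).symm
        _ ≤ Q.real (⋃ i, hit R R i) :=
            measureReal_mono (Set.iUnion_mono fun i p hp => ⟨hp.1, hsub _ _ hp.2⟩)
    have he : Real.exp (-(((k + 1 : ℕ) : ℝ) * ((k + 1 : ℕ) - 1) / 2 * w)) =
        Real.exp (-(k * w)) * Real.exp (-((k : ℝ) * (k - 1) / 2 * w)) := by
      rw [← Real.exp_add]; congr 1; push_cast; ring
    rw [he]
    have ha0 : 0 ≤ a := measureReal_nonneg
    calc a - Q.real (⋃ i, hit R R i) ≤ (-(k * w) + 1) * a := by linarith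
      _ ≤ Real.exp (-(k * w)) * a := mul_le_mul_of_nonneg_right (Real.add_one_le_exp _) ha0
      _ ≤ _ := mul_le_mul_of_nonneg_left ih (Real.exp_pos _).le

end Spread

/-! ### The measure of a spherical cap -/

section Cap

open scoped Pointwise

lemma geodesicDist_eq_angle {d : ℕ} (x y : UnitSphere d) :
    geodesicDist x y = InnerProductGeometry.angle
      (x : EuclideanSpace ℝ (Fin (d + 1))) (y : EuclideanSpace ℝ (Fin (d + 1))) := by
  simp [geodesicDist, InnerProductGeometry.angle]

lemma geodesicDist_comm {d : ℕ} (x y : UnitSphere d) : geodesicDist x y = geodesicDist y x := by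
  simp only [geodesicDist, real_inner_comm]

lemma geodesicDist_le_pi {d : ℕ} (x y : UnitSphere d) : geodesicDist x y ≤ Real.pi :=
  Real.arccos_le_pi _

lemma geodesicDist_nonneg {d : ℕ} (x y : UnitSphere d) : 0 ≤ geodesicDist x y :=
  Real.arccos_nonneg _

lemma geodesicDist_triangle {d : ℕ} (x y z : UnitSphere d) :
    geodesicDist x z ≤ geodesicDist x y + geodesicDist y z := by
  simp only [geodesicDist_eq_angle]
  exact InnerProductGeometry.angle_le_angle_add_angle _ _ _

lemma continuous_geodesicDist {d : ℕ} :
    Continuous fun p : UnitSphere d × UnitSphere d => geodesicDist p.1 p.2 := by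
  unfold geodesicDist
  fun_prop

/-- The punctured part inside the unit ball of the cone of half-angle `r` around `x`. -/
def coneSector {E : Type*} [NormedAddCommGroup E] [InnerProductSpace ℝ E] (x : E) (r : ℝ) : Set E :=
  {z | z ≠ 0 ∧ ‖z‖ < 1 ∧ InnerProductGeometry.angle x z ≤ r}

/-- `Measure.toSphere` is the dimension times the volume of the open unit cone over a set, so this
reduces cap measures to Lebesgue volumes. -/
lemma Ioo_smul_cap_eq_coneSector {d : ℕ} (x : UnitSphere d) (r : ℝ) :
    Set.Ioo (0 : ℝ) 1 • ((↑) '' {y : UnitSphere d | geodesicDist x y ≤ r}) =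
      coneSector (x : EuclideanSpace ℝ (Fin (d + 1))) r := by
  ext z
  simp only [Set.mem_smul, Set.mem_image, coneSector, Set.mem_ofPred_eq]
  constructor
  · rintro ⟨t, ht, _, ⟨y, hy, rfl⟩, rfl⟩
    have hy1 : ‖(y : EuclideanSpace ℝ (Fin (d + 1)))‖ = 1 := norm_eq_of_mem_sphere y
    refine ⟨smul_ne_zero ht.1.ne' (by rw [← norm_ne_zero_iff, hy1]; exact one_ne_zero), ?_, ?_⟩
    · rw [norm_smul, hy1, mul_one, Real.norm_of_nonneg ht.1.le]; exact ht.2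
    · rw [InnerProductGeometry.angle_smul_right_of_pos _ _ ht.1, ← geodesicDist_eq_angle]
      exact hy
  · rintro ⟨h0, h1, h2⟩
    have hz : 0 < ‖z‖ := norm_pos_iff.2 h0
    refine ⟨‖z‖, ⟨hz, h1⟩, ‖z‖⁻¹ • z, ⟨⟨‖z‖⁻¹ • z, ?_⟩, ?_, rfl⟩, ?_⟩
    · rw [mem_sphere_zero_iff_norm, norm_smul, norm_inv, norm_norm, inv_mul_cancel₀ hz.ne']
    · rw [geodesicDist_eq_angle]
      simpa [InnerProductGeometry.angle_smul_right_of_pos _ _ (inv_pos.2 hz)] using h2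
    · rw [smul_smul, mul_inv_cancel₀ hz.ne', one_smul]

/-- The reflection in the hyperplane orthogonal to `x - y` takes `x` to `y` and preserves norms,
angles and volume. -/
lemma volume_coneSector_congr {E : Type*} [NormedAddCommGroup E] [InnerProductSpace ℝ E]
    [FiniteDimensional ℝ E] [MeasurableSpace E] [BorelSpace E] {x y : E} (h : ‖x‖ = ‖y‖) (r : ℝ) :
    volume (coneSector x r) = volume (coneSector y r) := by
  set f := (Submodule.span ℝ {x - y})ᗮ.reflection
  have hf : f x = y := Submodule.reflection_sub h
  have hpre : coneSector x r = f.toMeasurableEquiv ⁻¹' coneSector y r := by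
    ext z
    simp only [coneSector, Set.mem_preimage, Set.mem_ofPred_eq, ← hf]
    have := f.toLinearIsometry.angle_map x z
    simp only [LinearIsometryEquiv.coe_toLinearIsometry] at this
    simp [this]
  rw [hpre]
  exact f.measurePreserving.measure_preimage_equiv _

lemma measurableSet_cap {d : ℕ} (x : UnitSphere d) (r : ℝ) :
    MeasurableSet {y : UnitSphere d | geodesicDist x y ≤ r} := by
  have h : Continuous fun y => geodesicDist x y := by
    unfold geodesicDist
    fun_prop
  exact (isClosed_le h continuous_const).measurableSet

instance {d : ℕ} : IsProbabilityMeasure (uniformSphere d) := by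
  refine ⟨?_⟩
  rw [uniformSphere, Measure.smul_apply, smul_eq_mul]
  exact ENNReal.inv_mul_cancel
    (by simp [(Metric.measure_ball_pos volume _ one_pos).ne']) (measure_ne_top _ _)

lemma uniformSphere_cap {d : ℕ} (x : UnitSphere d) (r : ℝ) :
    (uniformSphere d).real {y | geodesicDist x y ≤ r} =
      volume.real (coneSector (x : EuclideanSpace ℝ (Fin (d + 1))) r) /
        volume.real (Metric.ball (0 : EuclideanSpace ℝ (Fin (d + 1))) 1) := by
  rw [uniformSphere, measureReal_def, Measure.smul_apply, smul_eq_mul,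
    Measure.toSphere_apply' _ (measurableSet_cap x r), Ioo_smul_cap_eq_coneSector,
    Measure.toSphere_apply_univ]
  simp only [ENNReal.toReal_mul, ENNReal.toReal_inv, measureReal_def, finrank_euclideanSpace,
    Fintype.card_fin, ENNReal.toReal_natCast]
  have : ((d + 1 : ℕ) : ℝ) ≠ 0 := by positivity
  field_simp

/-- The pole `(1, 0, …, 0)` of the sphere. -/
noncomputable def pole (d : ℕ) : UnitSphere d :=
  ⟨EuclideanSpace.single 0 1, by simp⟩

/-- The normalized surface measure of a geodesic ball of radius `r`. -/
noncomputable def capMeasure (d : ℕ) (r : ℝ) : ℝ :=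
  (uniformSphere d).real {y | geodesicDist (pole d) y ≤ r}

lemma uniformSphere_cap_eq_capMeasure {d : ℕ} (x : UnitSphere d) (r : ℝ) :
    (uniformSphere d).real {y | geodesicDist x y ≤ r} = capMeasure d r := by
  rw [capMeasure, uniformSphere_cap, uniformSphere_cap, measureReal_def, measureReal_def,
    volume_coneSector_congr (y := (pole d : EuclideanSpace ℝ (Fin (d + 1)))), measureReal_def]
  rw [norm_eq_of_mem_sphere, norm_eq_of_mem_sphere]

lemma capMeasure_mono (d : ℕ) : Monotone (capMeasure d) := fun _ _ h =>
  measureReal_mono fun _ hy => le_trans hy h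

/-- The solid circular cone of slope `c` and height `h` around the first coordinate axis. -/
def solidCone (d : ℕ) (c h : ℝ) : Set (EuclideanSpace ℝ (Fin (d + 1))) :=
  {z | z 0 ∈ Set.Ioo 0 h ∧ ∑ i : Fin d, z i.succ ^ 2 ≤ (c * z 0) ^ 2}

/-- The slice at height `y` is a `d`-dimensional ball of radius `c y`; its volume is integrated over
`0 < y < h`. -/
lemma volume_solidCone {d : ℕ} (hd : 1 ≤ d) {c h : ℝ} (hc : 0 ≤ c) (hh : 0 ≤ h) :
    volume.real (solidCone d c h) =
      √Real.pi ^ d / Real.Gamma (d / 2 + 1) * c ^ d * (h ^ (d + 1) / (d + 1)) := by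
  have : Nonempty (Fin d) := ⟨⟨0, hd⟩⟩
  set V : ℝ := √Real.pi ^ d / Real.Gamma (d / 2 + 1)
  have hV : 0 ≤ V := div_nonneg (by positivity) (Real.Gamma_pos_of_pos (by positivity)).le
  set T : Set (ℝ × (Fin d → ℝ)) := {p | p.1 ∈ Set.Ioo 0 h ∧ ∑ i, p.2 i ^ 2 ≤ (c * p.1) ^ 2}
  have hT : MeasurableSet T := by
    refine (measurableSet_Ioo.preimage measurable_fst).inter ?_
    exact measurableSet_le (f := fun p : ℝ × (Fin d → ℝ) => ∑ i, p.2 i ^ 2)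
      (g := fun p => (c * p.1) ^ 2) (by fun_prop) (by fun_prop)
  have hpre : solidCone d c h =
      (fun z : EuclideanSpace ℝ (Fin (d + 1)) =>
        MeasurableEquiv.piFinSuccAbove (fun _ => ℝ) 0 z.ofLp) ⁻¹' T := rfl
  have hmp := (volume_preserving_piFinSuccAbove (fun _ : Fin (d + 1) => ℝ) 0).comp
    (PiLp.volume_preserving_ofLp (Fin (d + 1)))
  have hball : ∀ R : ℝ, 0 ≤ R → volume {u : Fin d → ℝ | ∑ i, u i ^ 2 ≤ R ^ 2} =
      ENNReal.ofReal (V * R ^ d) := by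
    intro R hR
    have h1 : {u : Fin d → ℝ | ∑ i, u i ^ 2 ≤ R ^ 2} =
        (WithLp.toLp 2) ⁻¹' (Metric.closedBall (0 : EuclideanSpace ℝ (Fin d)) R) := by
      ext u
      rw [Set.mem_preimage, mem_closedBall_zero_iff, ← sq_le_sq₀ (norm_nonneg _) hR,
        EuclideanSpace.norm_sq_eq]
      simp
    rw [h1, (PiLp.volume_preserving_toLp (Fin d)).measure_preimage
      Metric.isClosed_closedBall.measurableSet.nullMeasurableSet, EuclideanSpace.volume_closedBall,
      Fintype.card_fin, ← ENNReal.ofReal_pow hR, ← ENNReal.ofReal_mul (by positivity), mul_comm]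
  have hsec : ∀ y : ℝ, volume (Prod.mk y ⁻¹' T) =
      (Set.Ioo 0 h).indicator (fun y => ENNReal.ofReal (V * (c * y) ^ d)) y := by
    intro y
    by_cases hy : y ∈ Set.Ioo 0 h
    · rw [Set.indicator_of_mem hy, ← hball _ (mul_nonneg hc hy.1.le)]
      congr 1
      ext u
      simp only [T, Set.mem_preimage, Set.mem_ofPred_eq, hy, true_and]
    · have : Prod.mk y ⁻¹' T = ∅ := by
        ext u
        simp only [T, Set.mem_preimage, Set.mem_ofPred_eq, hy, false_and, Set.mem_empty_iff_false]
      rw [Set.indicator_of_notMem hy, this, measure_empty]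
  have hint : ∫ y in Set.Ioo 0 h, V * (c * y) ^ d = V * c ^ d * (h ^ (d + 1) / (d + 1)) := by
    rw [← integral_Ioc_eq_integral_Ioo, ← intervalIntegral.integral_of_le hh]
    simp_rw [mul_pow, ← mul_assoc]
    rw [intervalIntegral.integral_const_mul, integral_pow]
    simp
  have hI : IntegrableOn (fun y => V * (c * y) ^ d) (Set.Ioo 0 h) :=
    ((by fun_prop : Continuous fun y => V * (c * y) ^ d).integrableOn_Icc).mono_set
      Set.Ioo_subset_Icc_self
  rw [← hint, measureReal_def, hpre]
  erw [hmp.measure_preimage hT.nullMeasurableSet]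
  rw [Measure.volume_eq_prod, Measure.prod_apply hT]
  simp_rw [hsec]
  rw [lintegral_indicator measurableSet_Ioo,
    integral_eq_lintegral_of_nonneg_ae ?_ hI.aestronglyMeasurable]
  filter_upwards [ae_restrict_mem measurableSet_Ioo] with y hy
  exact mul_nonneg hV (pow_nonneg (mul_nonneg hc hy.1.le) _)

/-- The angle condition reads `cos r * ‖z‖ ≤ z 0`. Since `r < π / 2` makes `cos r` positive, it
forces `0 < z 0`, and squaring then loses nothing. -/
lemma angle_pole_le_iff {d : ℕ} {r : ℝ} (h0 : 0 < r) (h1 : r < Real.pi / 2)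
    {z : EuclideanSpace ℝ (Fin (d + 1))} (hz : z ≠ 0) :
    InnerProductGeometry.angle (pole d : EuclideanSpace ℝ (Fin (d + 1))) z ≤ r ↔
      0 < z 0 ∧ ∑ i : Fin d, z i.succ ^ 2 ≤ (Real.tan r * z 0) ^ 2 := by
  have hcos : 0 < Real.cos r := Real.cos_pos_of_mem_Ioo ⟨by linarith, h1⟩
  have hn : 0 < ‖z‖ := norm_pos_iff.2 hz
  have hangle : InnerProductGeometry.angle (pole d : EuclideanSpace ℝ (Fin (d + 1))) z =
      Real.arccos (z 0 / ‖z‖) := by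
    simp [InnerProductGeometry.angle, pole, EuclideanSpace.inner_single_left]
  have hstep : InnerProductGeometry.angle (pole d : EuclideanSpace ℝ (Fin (d + 1))) z ≤ r ↔
      Real.cos r * ‖z‖ ≤ z 0 := by
    rw [← le_div_iff₀ hn]
    constructor
    · intro h
      have := Real.cos_le_cos_of_nonneg_of_le_pi (InnerProductGeometry.angle_nonneg _ _)
        (by linarith) h
      rwa [InnerProductGeometry.cos_angle, norm_eq_of_mem_sphere, one_mul, pole,
        EuclideanSpace.inner_single_left, map_one, one_mul] at this
    · intro h
      rw [hangle, ← Real.arccos_cos h0.le (by linarith)]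
      exact Real.arccos_le_arccos h
  have hsq : ‖z‖ ^ 2 = z 0 ^ 2 + ∑ i : Fin d, z i.succ ^ 2 := by
    rw [EuclideanSpace.norm_sq_eq, Fin.sum_univ_succ]; simp
  have htan : Real.tan r * Real.cos r = Real.sin r := Real.tan_mul_cos hcos.ne'
  have hsc := Real.sin_sq_add_cos_sq r
  set s := ∑ i : Fin d, z i.succ ^ 2
  rw [hstep]
  have hkey : 0 < z 0 → (Real.cos r * ‖z‖ ≤ z 0 ↔ s ≤ (Real.tan r * z 0) ^ 2) := by
    intro hp
    rw [← sq_le_sq₀ (by positivity) hp.le, mul_pow, hsq,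
      ← mul_le_mul_iff_of_pos_left (pow_pos hcos 2) (b := s)]
    have : Real.cos r ^ 2 * (Real.tan r * z 0) ^ 2 = (1 - Real.cos r ^ 2) * z 0 ^ 2 := by
      rw [← mul_pow, ← mul_assoc, mul_comm (Real.cos r), htan, mul_pow]
      congr 1; linarith
    rw [this]
    constructor <;> intro h <;> linarith
  constructor
  · intro h
    have hp : 0 < z 0 := lt_of_lt_of_le (by positivity) h
    exact ⟨hp, (hkey hp).1 h⟩
  · rintro ⟨hp, h⟩
    exact (hkey hp).2 h

/-- The sector lies between straight cones of slope `tan r` with heights `cos r` and `1`. Their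
volumes differ by the factor `cos r ^ (d + 1)`, which tends to `1` as `r → 0`. -/
lemma coneSector_pole_subset {d : ℕ} {r : ℝ} (h0 : 0 < r) (h1 : r < Real.pi / 2) :
    coneSector (pole d : EuclideanSpace ℝ (Fin (d + 1))) r ⊆ solidCone d (Real.tan r) 1 := by
  rintro z ⟨hz, hz1, hzr⟩
  obtain ⟨hp, h⟩ := (angle_pole_le_iff h0 h1 hz).1 hzr
  refine ⟨⟨hp, ?_⟩, h⟩
  calc z 0 ≤ ‖z 0‖ := Real.le_norm_self _
    _ ≤ ‖z‖ := PiLp.norm_apply_le z 0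
    _ < 1 := hz1

lemma solidCone_subset_coneSector {d : ℕ} {r : ℝ} (h0 : 0 < r) (h1 : r < Real.pi / 2) :
    solidCone d (Real.tan r) (Real.cos r) ⊆
      coneSector (pole d : EuclideanSpace ℝ (Fin (d + 1))) r := by
  rintro z ⟨⟨hp, hlt⟩, h⟩
  have hz : z ≠ 0 := by rintro rfl; simp at hp
  have hcos : 0 < Real.cos r := Real.cos_pos_of_mem_Ioo ⟨by linarith, h1⟩
  refine ⟨hz, ?_, (angle_pole_le_iff h0 h1 hz).2 ⟨hp, h⟩⟩
  have hsq : ‖z‖ ^ 2 = z 0 ^ 2 + ∑ i : Fin d, z i.succ ^ 2 := by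
    rw [EuclideanSpace.norm_sq_eq, Fin.sum_univ_succ]; simp
  have htan : Real.tan r * Real.cos r = Real.sin r := Real.tan_mul_cos hcos.ne'
  have hsc := Real.sin_sq_add_cos_sq r
  have h2 : (Real.tan r * z 0) ^ 2 ≤ (Real.sin r) ^ 2 := by
    rw [← htan]
    have : 0 ≤ Real.tan r := (Real.tan_pos_of_pos_of_lt_pi_div_two h0 h1).le
    gcongr
  have h3 : z 0 ^ 2 < Real.cos r ^ 2 := by gcongr
  rw [← sq_lt_one_iff₀ (norm_nonneg _)]
  linarith

/-- This identifies `κ_d` as the ratio of the volume of the cone of slope and height `1` to that of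
the unit ball; `Γ(x + 1) = x Γ(x)` converts sphere areas into ball volumes. -/
lemma kappa_eq_ballVolume {d : ℕ} (hd : 1 ≤ d) :
    kappa d = √Real.pi ^ d / Real.Gamma (d / 2 + 1) / (d + 1) /
      volume.real (Metric.ball (0 : EuclideanSpace ℝ (Fin (d + 1))) 1) := by
  have hd0 : (0 : ℝ) < d := by exact_mod_cast hd
  have hV : volume.real (Metric.ball (0 : EuclideanSpace ℝ (Fin (d + 1))) 1) =
      √Real.pi ^ (d + 1) / Real.Gamma (((d : ℝ) + 1) / 2 + 1) := by
    have hG : 0 < Real.Gamma (((d : ℝ) + 1) / 2 + 1) := Real.Gamma_pos_of_pos (by positivity)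
    rw [measureReal_def, EuclideanSpace.volume_ball]
    simp only [ENNReal.ofReal_one, one_pow, one_mul, Fintype.card_fin]
    push_cast
    exact ENNReal.toReal_ofReal (by positivity)
  have hpow : ∀ n : ℕ, Real.pi ^ ((n : ℝ) / 2) = √Real.pi ^ n := by
    intro n
    rw [Real.sqrt_eq_rpow, ← Real.rpow_natCast, ← Real.rpow_mul Real.pi_pos.le]
    congr 1; ring
  have hcast : (((d - 1 : ℕ) : ℝ) + 1) = d := by
    rw [Nat.cast_sub hd]; push_cast; ring
  have h2 := hpow (d + 1)
  push_cast at h2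
  rw [hV, kappa, sphereArea, sphereArea, hcast, hpow, h2,
    Real.Gamma_add_one (by positivity), Real.Gamma_add_one (by positivity)]
  have hG1 : 0 < Real.Gamma ((d : ℝ) / 2) := Real.Gamma_pos_of_pos (by positivity)
  have hG2 : 0 < Real.Gamma (((d : ℝ) + 1) / 2) := Real.Gamma_pos_of_pos (by positivity)
  have hpi : 0 < √Real.pi := Real.sqrt_pos.2 Real.pi_pos
  field_simp

lemma kappa_pos {d : ℕ} (hd : 1 ≤ d) : 0 < kappa d := by
  have hd0 : (0 : ℝ) < d := by exact_mod_cast hd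
  have h : ∀ n : ℕ, 0 < sphereArea n := fun n =>
    div_pos (by positivity) (Real.Gamma_pos_of_pos (by positivity))
  exact mul_pos (by positivity) (div_pos (h _) (h _))

lemma capMeasure_eq {d : ℕ} (r : ℝ) :
    capMeasure d r = volume.real (coneSector (pole d : EuclideanSpace ℝ (Fin (d + 1))) r) /
        volume.real (Metric.ball (0 : EuclideanSpace ℝ (Fin (d + 1))) 1) :=
  uniformSphere_cap _ _

lemma coneSector_ne_top {d : ℕ} (r : ℝ) :
    volume (coneSector (pole d : EuclideanSpace ℝ (Fin (d + 1))) r) ≠ ⊤ :=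
  ((measure_mono fun _ hz => mem_ball_zero_iff.2 hz.2.1).trans_lt
    (measure_ball_lt_top (x := (0 : EuclideanSpace ℝ (Fin (d + 1)))) (r := 1))).ne

lemma le_capMeasure {d : ℕ} (hd : 1 ≤ d) {r : ℝ} (h0 : 0 < r) (h1 : r < Real.pi / 2) :
    kappa d * Real.tan r ^ d * Real.cos r ^ (d + 1) ≤ capMeasure d r := by
  have hcos : 0 < Real.cos r := Real.cos_pos_of_mem_Ioo ⟨by linarith, h1⟩
  have htan := (Real.tan_pos_of_pos_of_lt_pi_div_two h0 h1).le
  have h := measureReal_mono (μ := volume) (solidCone_subset_coneSector (d := d) h0 h1)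
    (coneSector_ne_top r)
  rw [volume_solidCone hd htan hcos.le] at h
  rw [capMeasure_eq, kappa_eq_ballVolume hd]
  refine le_trans (le_of_eq ?_) (div_le_div_of_nonneg_right h measureReal_nonneg)
  ring

lemma capMeasure_le {d : ℕ} (hd : 1 ≤ d) {r : ℝ} (h0 : 0 < r) (h1 : r < Real.pi / 2) :
    capMeasure d r ≤ kappa d * Real.tan r ^ d := by
  have htan := (Real.tan_pos_of_pos_of_lt_pi_div_two h0 h1).le
  have hvol := volume_solidCone hd htan zero_le_one
  have hcone : 0 < Real.tan r := Real.tan_pos_of_pos_of_lt_pi_div_two h0 h1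
  have hG : 0 < Real.Gamma ((d : ℝ) / 2 + 1) := Real.Gamma_pos_of_pos (by positivity)
  have hpi : 0 < √Real.pi := Real.sqrt_pos.2 Real.pi_pos
  -- An infinite volume would have real value `0`, contradicting the positive value in `hvol`.
  have hfin : volume (solidCone d (Real.tan r) 1) ≠ ⊤ := by
    intro h
    rw [measureReal_def, h, ENNReal.toReal_top] at hvol
    exact absurd hvol (by positivity)
  have h := measureReal_mono (μ := volume) (coneSector_pole_subset (d := d) h0 h1) hfin
  rw [hvol] at h
  rw [capMeasure_eq, kappa_eq_ballVolume hd]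
  refine (div_le_div_of_nonneg_right h measureReal_nonneg).trans (le_of_eq ?_)
  rw [one_pow]
  ring

/-- A geodesic ball of radius `r` has normalized measure asymptotic to `κ_d r ^ d`. -/
theorem tendsto_capMeasure_div_pow {d : ℕ} (hd : 1 ≤ d) :
    Tendsto (fun r => capMeasure d r / r ^ d) (𝓝[>] 0) (𝓝 (kappa d)) := by
  have htan : Tendsto (fun r : ℝ => Real.tan r / r) (𝓝[>] 0) (𝓝 1) := by
    have h := (Real.hasDerivAt_tan (x := 0) (by simp)).tendsto_slope_zero_right
    simp only [zero_add, Real.tan_zero, sub_zero, Real.cos_zero, one_pow, div_one,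
      smul_eq_mul] at h
    exact h.congr fun r => by ring
  have hcos : Tendsto Real.cos (𝓝[>] 0) (𝓝 1) := by
    have := Real.continuous_cos.tendsto 0
    rw [Real.cos_zero] at this
    exact this.mono_left nhdsWithin_le_nhds
  have hmem : Set.Ioo (0 : ℝ) (Real.pi / 2) ∈ 𝓝[>] (0 : ℝ) :=
    Ioo_mem_nhdsGT (by positivity)
  have hup : Tendsto (fun r : ℝ => kappa d * (Real.tan r / r) ^ d) (𝓝[>] 0) (𝓝 (kappa d)) := by
    simpa using (htan.pow d).const_mul (kappa d)
  have hlo : Tendsto (fun r : ℝ => kappa d * (Real.tan r / r) ^ d * Real.cos r ^ (d + 1))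
      (𝓝[>] 0) (𝓝 (kappa d)) := by
    simpa using hup.mul (hcos.pow (d + 1))
  refine tendsto_of_tendsto_of_tendsto_of_le_of_le' hlo hup ?_ ?_
  · filter_upwards [hmem] with r hr
    rw [le_div_iff₀ (pow_pos hr.1 d)]
    refine le_trans (le_of_eq ?_) (le_capMeasure hd hr.1 hr.2)
    have := hr.1.ne'
    rw [div_pow]
    field_simp
  · filter_upwards [hmem] with r hr
    rw [div_le_iff₀ (pow_pos hr.1 d)]
    refine (capMeasure_le hd hr.1 hr.2).trans (le_of_eq ?_)
    have := hr.1.ne'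
    rw [div_pow]
    field_simp

/-- The tail bound needs a lower estimate at all radii up to `π`, not only asymptotically. Shrinking
`r` to `r / π ≤ 1 < π / 2` brings it into the range of `le_capMeasure`, and monotonicity returns to
`r`. -/
lemma exists_pow_le_capMeasure {d : ℕ} (hd : 1 ≤ d) :
    ∃ c : ℝ, 0 < c ∧ ∀ r, 0 < r → r ≤ Real.pi → c * r ^ d ≤ capMeasure d r := by
  have hpi := Real.pi_gt_three
  have hk := kappa_pos hd
  have hc1 : 0 < Real.cos 1 := Real.cos_one_pos
  refine ⟨kappa d * Real.cos 1 ^ (d + 1) / Real.pi ^ d, by positivity, fun r h0 h1 => ?_⟩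
  have hs0 : 0 < r / Real.pi := by positivity
  have hs1 : r / Real.pi ≤ 1 := (div_le_one Real.pi_pos).2 h1
  have hsle : r / Real.pi ≤ r := div_le_self h0.le (by linarith)
  have htan : r / Real.pi ≤ Real.tan (r / Real.pi) := Real.le_tan hs0.le (by linarith)
  have hcos : Real.cos 1 ≤ Real.cos (r / Real.pi) :=
    Real.cos_le_cos_of_nonneg_of_le_pi hs0.le (by linarith) hs1
  have htan0 : 0 ≤ Real.tan (r / Real.pi) := hs0.le.trans htan
  calc kappa d * Real.cos 1 ^ (d + 1) / Real.pi ^ d * r ^ d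
      = kappa d * (r / Real.pi) ^ d * Real.cos 1 ^ (d + 1) := by rw [div_pow]; ring
    _ ≤ kappa d * Real.tan (r / Real.pi) ^ d * Real.cos (r / Real.pi) ^ (d + 1) := by gcongr
    _ ≤ capMeasure d (r / Real.pi) := le_capMeasure hd hs0 (by linarith)
    _ ≤ capMeasure d r := capMeasure_mono d hsle

end Cap

/-! ### Tail bound and limit law of the separation -/

section Separation

variable {d N : ℕ}

lemma separation_nonneg (x : Fin N → UnitSphere d) : 0 ≤ separation x :=
  Real.iInf_nonneg fun _ => geodesicDist_nonneg _ _

lemma separation_le_pi (x : Fin N → UnitSphere d) : separation x ≤ Real.pi := by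
  unfold separation
  cases isEmpty_or_nonempty {p : Fin N × Fin N // p.1 < p.2} with
  | inl h => rw [Real.iInf_of_isEmpty]; exact Real.pi_pos.le
  | inr h =>
    obtain ⟨p, hp⟩ := exists_eq_ciInf_of_finite
      (f := fun p : {p : Fin N × Fin N // p.1 < p.2} => geodesicDist (x p.1.1) (x p.1.2))
    rw [← hp]
    exact geodesicDist_le_pi _ _

lemma measurable_separation :
    Measurable (separation : (Fin N → UnitSphere d) → ℝ) := by
  unfold separation
  refine Measurable.iInf fun p => ?_
  have h : Continuous fun x : Fin N → UnitSphere d => geodesicDist (x p.1.1) (x p.1.2) := by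
    unfold geodesicDist
    fun_prop
  exact h.measurable

/-- The minimum over finitely many pairs is attained, so strictness survives. For `N < 2` every
configuration is spread while `separation` is `0`, so the equivalence would fail for `r ≥ 0`. -/
lemma lt_separation_iff (hN : 2 ≤ N) (x : Fin N → UnitSphere d) (r : ℝ) :
    r < separation x ↔ x ∈ spread (fun x y => geodesicDist x y ≤ r) N := by
  have : Nonempty {p : Fin N × Fin N // p.1 < p.2} :=
    ⟨⟨(⟨0, by omega⟩, ⟨1, by omega⟩), by simp⟩⟩
  obtain ⟨p, hp⟩ := exists_eq_ciInf_of_finite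
    (f := fun p : {p : Fin N × Fin N // p.1 < p.2} => geodesicDist (x p.1.1) (x p.1.2))
  simp only [spread, Set.mem_ofPred_eq, not_le]
  constructor
  · intro h i j hij
    exact h.trans_le (ciInf_le (Set.finite_range _).bddBelow
      (⟨(i, j), hij⟩ : {p : Fin N × Fin N // p.1 < p.2}))
  · intro h
    unfold separation
    rw [← hp]
    exact h _ _ p.2

lemma measurableSet_geodesicDist_le (r : ℝ) :
    MeasurableSet {p : UnitSphere d × UnitSphere d | geodesicDist p.1 p.2 ≤ r} :=
  (isClosed_le continuous_geodesicDist continuous_const).measurableSet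

lemma uniformSphere_cap_eq_capMeasure' (x : UnitSphere d) (r : ℝ) :
    (uniformSphere d).real {y | geodesicDist y x ≤ r} = capMeasure d r := by
  simp_rw [geodesicDist_comm _ x]
  exact uniformSphere_cap_eq_capMeasure x r

/-- Uniform tail bound for the rescaled separation of `N` independent uniform points. -/
lemma exists_tail_bound (hd : 1 ≤ d) : ∃ c : ℝ, 0 < c ∧ ∀ N : ℕ, 2 ≤ N → ∀ t : ℝ, 0 < t →
    (Measure.pi fun _ : Fin N => uniformSphere d).real
      {x | t < (N : ℝ) ^ (2 / (d : ℝ)) * separation x} ≤ Real.exp (-c * t ^ (d : ℝ)) := by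
  obtain ⟨c, hc, hcap⟩ := exists_pow_le_capMeasure hd
  -- The factor `2 ^ d` comes from the half radius, and `4` from `N (N - 1) / 2 ≥ N² / 4`, valid for
  -- `N ≥ 2`.
  refine ⟨c / (4 * 2 ^ d), by positivity, fun N hN t ht => ?_⟩
  have hN0 : (0 : ℝ) < N := by exact_mod_cast (by omega : 0 < N)
  have hN2 : (2 : ℝ) ≤ N := by exact_mod_cast hN
  have hd0 : (d : ℝ) ≠ 0 := by exact_mod_cast (by omega : d ≠ 0)
  have hs : 0 < (N : ℝ) ^ (2 / (d : ℝ)) := Real.rpow_pos_of_pos hN0 _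
  set r := t / (N : ℝ) ^ (2 / (d : ℝ))
  have hr : 0 < r := div_pos ht hs
  have hset : {x : Fin N → UnitSphere d | t < (N : ℝ) ^ (2 / (d : ℝ)) * separation x} =
      {x | r < separation x} := by
    ext x; simp only [Set.mem_ofPred_eq, r]; rw [div_lt_iff₀' hs]
  have hspread : {x : Fin N → UnitSphere d | r < separation x} =
      spread (fun x y => geodesicDist x y ≤ r) N := by
    ext x; exact lt_separation_iff hN x r
  rw [hset]
  by_cases hrpi : r ≤ Real.pi
  · rw [hspread]
    refine (measureReal_spread_le_exp (uniformSphere d) (measurableSet_geodesicDist_le r)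
      (measurableSet_geodesicDist_le (r / 2)) (fun x => uniformSphere_cap_eq_capMeasure' x (r / 2))
      (fun x y h => h.trans (by linarith)) (fun x y z h1 h2 => ?_) N).trans ?_
    · have := geodesicDist_triangle x z y
      rw [geodesicDist_comm x z] at this
      linarith
    · rw [Real.exp_le_exp, neg_mul, neg_le_neg_iff]
      have h1 := hcap (r / 2) (by positivity) (by linarith)
      -- This is what fixes the scaling `N^(2/d)`: cap measures become of order `N⁻²`, matching the
      -- number of pairs.
      have hrd : r ^ d = t ^ d / (N : ℝ) ^ 2 := by
        rw [div_pow, ← Real.rpow_natCast ((N : ℝ) ^ (2 / (d : ℝ))), ← Real.rpow_mul hN0.le,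
          div_mul_cancel₀ _ hd0, Real.rpow_ofNat]
      rw [Real.rpow_natCast]
      calc c / (4 * 2 ^ d) * t ^ d = (N : ℝ) ^ 2 / 4 * (c * (r / 2) ^ d) := by
            rw [div_pow, hrd]; field_simp
        _ ≤ (N : ℝ) * (N - 1) / 2 * (c * (r / 2) ^ d) := by
            apply mul_le_mul_of_nonneg_right _ (by positivity)
            nlinarith
        _ ≤ (N : ℝ) * (N - 1) / 2 * capMeasure d (r / 2) := by
            apply mul_le_mul_of_nonneg_left h1
            apply div_nonneg (mul_nonneg hN0.le (by linarith)) zero_le_two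
  -- Beyond `π`, where the cap estimate stops, the event is impossible.
  · have : {x : Fin N → UnitSphere d | r < separation x} = ∅ := by
      ext x
      simp only [Set.mem_ofPred_eq, Set.mem_empty_iff_false, iff_false, not_lt]
      exact (separation_le_pi x).trans (le_of_not_ge hrpi)
    rw [this, measureReal_empty]
    exact (Real.exp_pos _).le

/-- Limit law of the rescaled separation of `N` independent uniform points. -/
lemma tendsto_survival (hd : 1 ≤ d) {t : ℝ} (ht : 0 < t) :
    Tendsto (fun N : ℕ => (Measure.pi fun _ : Fin N => uniformSphere d).real
      {x | t < (N : ℝ) ^ (2 / (d : ℝ)) * separation x}) atTop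
      (𝓝 (Real.exp (-(kappa d / 2) * t ^ (d : ℝ)))) := by
  have hdpos : (0 : ℝ) < d := by exact_mod_cast hd
  have hd0 := hdpos.ne'
  set r : ℕ → ℝ := fun N => t / (N : ℝ) ^ (2 / (d : ℝ))
  set v : ℕ → ℝ := fun N => capMeasure d (r N)
  have hr : Tendsto r atTop (𝓝[>] 0) := by
    refine tendsto_nhdsWithin_iff.2 ⟨?_, ?_⟩
    · exact ((tendsto_rpow_atTop (by positivity)).comp
        tendsto_natCast_atTop_atTop).const_div_atTop t
    · filter_upwards [eventually_gt_atTop 0] with N hN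
      exact div_pos ht (Real.rpow_pos_of_pos (by exact_mod_cast hN) _)
  have hv : Tendsto (fun N : ℕ => (N : ℝ) ^ 2 * v N) atTop (𝓝 (kappa d * t ^ d)) := by
    refine Tendsto.congr' ?_ (((tendsto_capMeasure_div_pow hd).comp hr).mul_const (t ^ d))
    filter_upwards [eventually_gt_atTop 0] with N hN
    have hN0 : (0 : ℝ) < N := by exact_mod_cast hN
    have hrd : r N ^ d = t ^ d / (N : ℝ) ^ 2 := by
      simp only [r]
      rw [div_pow, ← Real.rpow_natCast ((N : ℝ) ^ (2 / (d : ℝ))), ← Real.rpow_mul hN0.le,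
        div_mul_cancel₀ _ hd0, Real.rpow_ofNat]
    simp only [Function.comp_apply, hrd, v]
    field_simp
  have hinv : Tendsto (fun N : ℕ => (N : ℝ)⁻¹) atTop (𝓝 0) := tendsto_inv_atTop_nhds_zero_nat
  -- The error is `(N² v)² / N`, and `N² v` converges.
  have herr : Tendsto (fun N : ℕ => (N : ℝ) ^ 3 * v N ^ 2) atTop (𝓝 0) := by
    have h := (hv.pow 2).mul hinv
    rw [mul_zero] at h
    refine h.congr' ?_
    filter_upwards [eventually_gt_atTop 0] with N hN
    have hN0 : (0 : ℝ) < N := by exact_mod_cast hN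
    field_simp
  have hmain : Tendsto (fun N : ℕ => Real.exp (-((N : ℝ) * (N - 1) / 2 * v N))) atTop
      (𝓝 (Real.exp (-(kappa d / 2) * t ^ (d : ℝ)))) := by
    refine (Real.continuous_exp.tendsto _).comp ?_
    -- The exponent is written as `N² v (1 - 1/N) / (-2)`.
    have h := (hv.mul (hinv.const_sub 1)).div_const (-2)
    rw [Real.rpow_natCast]
    convert! h.congr' ?_ using 2
    · ring
    · filter_upwards [eventually_gt_atTop 0] with N hN
      have hN0 : (0 : ℝ) < N := by exact_mod_cast hN
      field_simp
  have hdiff := squeeze_zero_norm' (f := fun N : ℕ =>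
    (Measure.pi fun _ : Fin N => uniformSphere d).real
      {x | t < (N : ℝ) ^ (2 / (d : ℝ)) * separation x} -
      Real.exp (-((N : ℝ) * (N - 1) / 2 * v N))) ?_ herr
  · simpa using hdiff.add hmain
  · filter_upwards [eventually_ge_atTop 2] with N hN
    have hN0 : (0 : ℝ) < N := by exact_mod_cast (by omega : 0 < N)
    have hset : {x : Fin N → UnitSphere d | t < (N : ℝ) ^ (2 / (d : ℝ)) * separation x} =
        spread (fun x y => geodesicDist x y ≤ r N) N := by
      ext x
      rw [← lt_separation_iff hN, Set.mem_ofPred_eq,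
        div_lt_iff₀' (Real.rpow_pos_of_pos hN0 _)]
    rw [hset, Real.norm_eq_abs]
    exact abs_measureReal_spread_sub_exp_le _ (measurableSet_geodesicDist_le _)
      (fun x => uniformSphere_cap_eq_capMeasure' x _)
      (fun x => uniformSphere_cap_eq_capMeasure x _) N

end Separation

/-! ### From survival functions to moments -/

section Moments

lemma lintegral_exp_neg_mul_rpow_mul_rpow {b p q : ℝ} (hb : 0 < b) (hp : 0 < p) (hq : 0 < q) :
    ∫⁻ t in Set.Ioi (0 : ℝ), ENNReal.ofReal (Real.exp (-b * t ^ q)) * ENNReal.ofReal (t ^ (p - 1)) =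
      ENNReal.ofReal (b ^ (-(p / q)) * (1 / q) * Real.Gamma (p / q)) := by
  have h := integral_rpow_mul_exp_neg_mul_rpow (p := q) (q := p - 1) hq (by linarith) hb
  rw [sub_add_cancel, neg_div] at h
  rw [← h, ofReal_integral_eq_lintegral_ofReal
    (integrableOn_rpow_mul_exp_neg_mul_rpow (by linarith) hq hb)]
  · refine lintegral_congr fun t => ?_
    rw [← ENNReal.ofReal_mul (Real.exp_pos _).le, mul_comm]
  · filter_upwards [ae_restrict_mem measurableSet_Ioi] with t ht
    exact mul_nonneg (Real.rpow_nonneg (le_of_lt ht) _) (Real.exp_pos _).le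

/-- Nonnegative random variables converging in law to a Weibull distribution, with uniform Weibull
tails, have convergent moments. -/
theorem tendsto_integral_rpow_of_weibull_tail {Ω : ℕ → Type*} [∀ N, MeasurableSpace (Ω N)]
    (P : ∀ N, Measure (Ω N)) (f : ∀ N, Ω N → ℝ) (hf0 : ∀ N ω, 0 ≤ f N ω)
    (hf : ∀ N, AEMeasurable (f N) (P N)) {b c q : ℝ} (hb : 0 < b) (hc : 0 < c) (hq : 0 < q)
    (hbound : ∀ᶠ N in atTop, ∀ t, 0 < t →
      P N {ω | t < f N ω} ≤ ENNReal.ofReal (Real.exp (-c * t ^ q)))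
    (hlim : ∀ t, 0 < t → Tendsto (fun N => P N {ω | t < f N ω}) atTop
      (𝓝 (ENNReal.ofReal (Real.exp (-b * t ^ q))))) {p : ℝ} (hp : 0 < p) :
    Tendsto (fun N => ∫ ω, f N ω ^ p ∂(P N)) atTop
      (𝓝 (b ^ (-(p / q)) * Real.Gamma (1 + p / q))) := by
  -- Layer-cake formula: the moment depends only on the survival function, to which dominated
  -- convergence applies.
  have hI : ∀ N, ∫ ω, f N ω ^ p ∂(P N) = (ENNReal.ofReal p * ∫⁻ t in Set.Ioi (0 : ℝ),
      P N {ω | t < f N ω} * ENNReal.ofReal (t ^ (p - 1))).toReal := by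
    intro N
    rw [integral_eq_lintegral_of_nonneg_ae (ae_of_all _ fun ω => Real.rpow_nonneg (hf0 N ω) _)
      ((hf N).pow_const p).aestronglyMeasurable,
      lintegral_rpow_eq_lintegral_meas_lt_mul _ (ae_of_all _ (hf0 N)) (hf N) hp]
  have hG : b ^ (-(p / q)) * Real.Gamma (1 + p / q) =
      (ENNReal.ofReal p * ∫⁻ t in Set.Ioi (0 : ℝ),
        ENNReal.ofReal (Real.exp (-b * t ^ q)) * ENNReal.ofReal (t ^ (p - 1))).toReal := by
    have hg : 0 < Real.Gamma (p / q) := Real.Gamma_pos_of_pos (by positivity)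
    rw [lintegral_exp_neg_mul_rpow_mul_rpow hb hp hq, ← ENNReal.ofReal_mul hp.le,
      ENNReal.toReal_ofReal (by positivity), add_comm, Real.Gamma_add_one (by positivity)]
    ring
  simp_rw [hI]
  rw [hG]
  have hfin : ∀ {a : ℝ}, 0 < a → ∫⁻ t in Set.Ioi (0 : ℝ),
      ENNReal.ofReal (Real.exp (-a * t ^ q)) * ENNReal.ofReal (t ^ (p - 1)) ≠ ⊤ := fun ha => by
    rw [lintegral_exp_neg_mul_rpow_mul_rpow ha hp hq]; exact ENNReal.ofReal_ne_top
  refine (ENNReal.tendsto_toReal (ENNReal.mul_ne_top ENNReal.ofReal_ne_top (hfin hb))).comp ?_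
  refine ENNReal.Tendsto.const_mul ?_ (Or.inr ENNReal.ofReal_ne_top)
  refine tendsto_lintegral_filter_of_dominated_convergence
    (fun t => ENNReal.ofReal (Real.exp (-c * t ^ q)) * ENNReal.ofReal (t ^ (p - 1))) ?_ ?_
    (hfin hc) ?_
  -- A survival function is measurable in `t` because it is antitone.
  · refine Eventually.of_forall fun N => Measurable.mul ?_ (by fun_prop)
    have : Antitone fun t : ℝ => P N {ω | t < f N ω} := fun s t h =>
      measure_mono fun ω hω => lt_of_le_of_lt h hω
    exact this.measurable
  · filter_upwards [hbound] with N hN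
    filter_upwards [ae_restrict_mem measurableSet_Ioi] with t ht
    exact mul_le_mul_left (hN t ht) _
  · filter_upwards [ae_restrict_mem measurableSet_Ioi] with t ht
    exact ENNReal.Tendsto.mul_const (hlim t ht) (Or.inr ENNReal.ofReal_ne_top)

end Moments

/-! ### Limits of the mean and the variance -/

theorem corollary3p3 (d : ℕ) (hd : 1 ≤ d)
    {Ω : ℕ → Type*} [∀ N, MeasurableSpace (Ω N)]
    (P : ∀ N, Measure (Ω N)) [∀ N, IsProbabilityMeasure (P N)]
    (X : ∀ N, Fin N → Ω N → UnitSphere d)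
    (hindep : ∀ N, iIndepFun (X N) (P N))
    (hunif : ∀ N i, HasLaw (X N i) (uniformSphere d) (P N)) :
    (∀ N : ℕ, 2 ≤ N →
      MemLp (fun ω => (N : ℝ) ^ (2 / (d : ℝ)) * separation (fun i => X N i ω)) 2 (P N)) ∧
    Tendsto
      (fun N : ℕ => ∫ ω, (N : ℝ) ^ (2 / (d : ℝ)) * separation (fun i => X N i ω) ∂(P N))
      atTop
      (𝓝 ((kappa d / 2) ^ (-(1 / (d : ℝ))) * Real.Gamma (1 + 1 / (d : ℝ)))) ∧
    Tendsto
      (fun N : ℕ =>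
        variance (fun ω => (N : ℝ) ^ (2 / (d : ℝ)) * separation (fun i => X N i ω)) (P N))
      atTop
      (𝓝 ((kappa d / 2) ^ (-(2 / (d : ℝ))) *
        (Real.Gamma (1 + 2 / (d : ℝ)) - Real.Gamma (1 + 1 / (d : ℝ)) ^ 2))) := by
  have hdpos : (0 : ℝ) < d := by exact_mod_cast hd
  have hb : 0 < kappa d / 2 := half_pos (kappa_pos hd)
  set f : ∀ N : ℕ, Ω N → ℝ := fun N ω =>
    (N : ℝ) ^ (2 / (d : ℝ)) * separation (fun i => X N i ω)
  have hX : ∀ N, AEMeasurable (fun ω i => X N i ω) (P N) := fun N =>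
    aemeasurable_pi_lambda _ fun i => (hunif N i).aemeasurable
  -- Independence makes the joint law the product measure, so the spaces `Ω N` play no further role
  -- in the survival probabilities.
  have hlaw : ∀ N, (P N).map (fun ω i => X N i ω) = Measure.pi fun _ => uniformSphere d := by
    intro N
    rw [(iIndepFun_iff_map_fun_eq_pi_map fun i => (hunif N i).aemeasurable).1 (hindep N)]
    simp_rw [(hunif N _).map_eq]
  have hf : ∀ N, AEMeasurable (f N) (P N) := fun N =>
    (measurable_separation.comp_aemeasurable (hX N)).const_mul _
  have hf0 : ∀ N ω, 0 ≤ f N ω := fun N ω =>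
    mul_nonneg (Real.rpow_nonneg (Nat.cast_nonneg _) _) (separation_nonneg _)
  -- For each fixed `N` the variable is bounded, since angles are at most `π`.
  have hmem : ∀ N, MemLp (f N) 2 (P N) := by
    refine fun N => MemLp.of_bound (hf N).aestronglyMeasurable
      ((N : ℝ) ^ (2 / (d : ℝ)) * Real.pi) (ae_of_all _ fun ω => ?_)
    rw [Real.norm_of_nonneg (hf0 N ω)]
    exact mul_le_mul_of_nonneg_left (separation_le_pi _)
      (Real.rpow_nonneg (Nat.cast_nonneg _) _)
  have hsurv : ∀ N t, P N {ω | t < f N ω} =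
      ENNReal.ofReal ((Measure.pi fun _ : Fin N => uniformSphere d).real
        {x | t < (N : ℝ) ^ (2 / (d : ℝ)) * separation x}) := by
    intro N t
    rw [ofReal_measureReal, ← hlaw N, Measure.map_apply_of_aemeasurable (hX N)]
    · rfl
    · exact measurableSet_lt measurable_const (measurable_separation.const_mul _)
  obtain ⟨c, hc, htail⟩ := exists_tail_bound hd
  -- Only `p = 1` and `p = 2` are used; the variance limit is the second moment limit minus the
  -- square of the first.
  have hmom : ∀ p : ℝ, 0 < p → Tendsto (fun N => ∫ ω, f N ω ^ p ∂(P N)) atTop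
      (𝓝 ((kappa d / 2) ^ (-(p / d)) * Real.Gamma (1 + p / d))) := by
    refine fun p hp => tendsto_integral_rpow_of_weibull_tail P f hf0 hf hb hc hdpos ?_ ?_ hp
    · filter_upwards [eventually_ge_atTop 2] with N hN t ht
      rw [hsurv]
      exact ENNReal.ofReal_le_ofReal (htail N hN t ht)
    · intro t ht
      simp_rw [hsurv]
      exact ENNReal.tendsto_ofReal (tendsto_survival hd ht)
  have h1 := hmom 1 one_pos
  have h2 := hmom 2 two_pos
  simp only [Real.rpow_one] at h1
  simp only [Real.rpow_ofNat] at h2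
  refine ⟨fun N _ => hmem N, h1, ?_⟩
  have hvar : ∀ N, variance (f N) (P N) = ∫ ω, f N ω ^ 2 ∂(P N) - (∫ ω, f N ω ∂(P N)) ^ 2 :=
    fun N => variance_eq_sub (hmem N)
  have hsq : ((kappa d / 2) ^ (-(1 / (d : ℝ)))) ^ 2 = (kappa d / 2) ^ (-(2 / (d : ℝ))) := by
    rw [← Real.rpow_natCast, ← Real.rpow_mul hb.le]
    congr 1; push_cast; ring
  have hlim := h2.sub (h1.pow 2)
  rw [mul_pow, hsq, ← mul_sub] at hlim
  exact hlim.congr fun N => (hvar N).symm
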